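/- Let $p$ be an odd prime, $\zeta_p=e^{2\pi\sqrt{-1}/p}$, and $\epsilon=\sqrt{(-1)^{(p-1)/2}}$, i.e. $\epsilon=1$ if $p\equiv1\pmod 4$ and $\epsilon=\sqrt{-1}$ if $p\equiv3\pmod 4$. Let $n,m,t,n_1,\dots,n_s$ be positive integers with $n=\sum_{j=1}^s n_j$, $t\mid n_j$ for all $j$, $t\mid m$, $2\mid n-m$ and $n\ge 3m$. Let $V=\mathbb F_{p^{n_1}}\times\cdots\times\mathbb F_{p^{n_s}}$ with the inner product $\langle a,x\rangle=\sum_{j=1}^s\mathrm{Tr}_{p^{n_j}/p}(a_jx_j)$, and let $\chi_1(x)=\zeta_p^{\langle 1,x\rangle}$ with $1=(1,\dots,1)$, so that $\chi_1(ax)=\zeta_p^{\langle a,x\rangle}$, where $ax$ is the componentwise product. Let $\eta_m$ be the quadratic character of $\mathbb F_{p^m}$, with $\eta_m(0)=0$. For $f:V\to\mathbb F_p$ put $W_f(a)=\sum_{x\in V}\zeta_p^{f(x)-\langle a,x\rangle}$. The function $f$ is bent if $|W_f(a)|=p^{n/2}$ for all $a\in V$. The dual of a bent function $f$ is the function $f^*:V\to\mathbb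 F_p$ such that, for every $a\in V$, $W_f(a)=\pm p^{n/2}\zeta_p^{f^*(a)}$ if $p\equiv1\pmod4$ or $n$ is even, and $W_f(a)=\pm\sqrt{-1}\,p^{n/2}\zeta_p^{f^*(a)}$ otherwise, the sign possibly depending on $a$. The bent function $f$ is weakly regular with sign $\varepsilon_f\in\{\pm1,\pm\sqrt{-1}\}$ if $W_f(a)=\varepsilon_f\,p^{n/2}\zeta_p^{f^*(a)}$ for all $a\in V$. For $F:V\to\mathbb F_{p^m}$ and $c\in\mathbb F_{p^m}^*$ put $F_c(x)=\mathrm{Tr}_{p^m/p}(cF(x))$. The function $F$ is vectorial bent if all $F_c$, $c\in\mathbb F_{p^m}^*$, are bent; a vectorial dual of a vectorial bent function $F$ is a vectorial bent function $G:V\to\mathbb F_{p^m}$ such that, for some permutation $\sigma$ of $\mathbb F_{p^m}^*$, $(F_c)^*=G_{\sigma(c)}$ for all $c\in\mathbb F_{p^m}^*$; and $F$ is vectorial dual-bent if it has a vectorial dual. Let $F:V\to\mathbb F_{p^m}$ be a vectorial dual-bent function satisfying Condition II, that is, for some integers $l,d$ with $\gcd(d-1,p^m-1)=1$ and $(l-1)(d-1)\equiv1\pmod{p^m-1}$: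 1. $F$ has a vectorial dual $F^*$ with $(F_c)^*=(F^*)_{c^{1-d}}$ for all $c\in\mathbb F_{p^m}^*$; 2. $F(0)=0$, and $F(bx)=b^lF(x)$ for all $b\in\mathbb F_{p^t}^*$ and $x\in V$; 3. every $F_c$, $c\in\mathbb F_{p^m}^*$, is weakly regular with $\varepsilon_{F_c}=\upsilon\,\eta_m(c)$, where $\upsilon\in\{\pm\epsilon^m\}$ is a constant. Then for every $a\in V\setminus\{0\}$ the sum $S_2=\sum_{x\in V}\eta_m(F(x))\,\chi_1(ax)$ equals $$S_2=\begin{cases}\dfrac{p^m-1}{p^m}\,\upsilon\,p^{n/2}(-1)^{m-1}\epsilon^m\sqrt{p^m}\,\eta_m(-1)&\text{if }F^*(a)=0,\\[2mm]-\dfrac{1}{p^m}\,\upsilon\,p^{n/2}(-1)^{m-1}\epsilon^m\sqrt{p^m}\,\eta_m(-1)&\text{if }F^*(a)\ne0.\end{cases}$$ -/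

import Mathlib

noncomputable section

namespace HybridSum

/-- The number `ε = √((-1)^((p-1)/2))` (principal square root): `1` if `p ≡ 1 (mod 4)` and the
imaginary unit if `p ≡ 3 (mod 4)`. -/
def epsilon (p : ℕ) : ℂ := ((-1 : ℂ) ^ ((p - 1) / 2)) ^ (1 / 2 : ℂ)

theorem epsilon_of_mod_four_eq_one {p : ℕ} (h : p % 4 = 1) : epsilon p = 1 := by
  have h2 : Even ((p - 1) / 2) := by rw [Nat.even_iff]; omega
  simp [epsilon, h2.neg_one_pow]

theorem epsilon_of_mod_four_eq_three {p : ℕ} (h : p % 4 = 3) : epsilon p = Complex.I := by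
  have h2 : Odd ((p - 1) / 2) := by rw [Nat.odd_iff]; omega
  rw [epsilon, h2.neg_one_pow, Complex.cpow_def_of_ne_zero (by norm_num), Complex.log_neg_one]
  rw [show (Real.pi : ℂ) * Complex.I * (1 / 2) = Real.pi / 2 * Complex.I by ring,
    Complex.exp_pi_div_two_mul_I]

section
variable (p : ℕ) [Fact p.Prime] {s : ℕ} {K : Fin s → Type*} [∀ j, Field (K j)]
  [∀ j, Fintype (K j)] [∀ j, Algebra (ZMod p) (K j)]

/-- The inner product `⟨a, x⟩ = ∑ j, Tr(a_j x_j)` on a product of finite fields of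
characteristic `p`, with values in the prime field. -/
def innerProd (a x : ∀ j, K j) : ZMod p := ∑ j, Algebra.trace (ZMod p) (K j) (a j * x j)

/-- The additive character `χ_a(x) = ζ_p ^ ⟨a, x⟩`, where `ζ_p = exp(2πi/p)`. -/
def addChi (a x : ∀ j, K j) : ℂ := ZMod.stdAddChar (innerProd p a x)

/-- The Walsh transform `W_f(a) = ∑ x, ζ_p ^ (f(x) - ⟨a, x⟩)`. -/
def walsh (f : (∀ j, K j) → ZMod p) (a : ∀ j, K j) : ℂ :=
  ∑ x, ZMod.stdAddChar (f x - innerProd p a x)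

/-- `f` is a bent function on the `n`-dimensional space `∏ j, K j`. -/
def IsBent (n : ℕ) (f : (∀ j, K j) → ZMod p) : Prop :=
  ∀ a, ‖walsh p f a‖ = (p : ℝ) ^ ((n : ℝ) / 2)

/-- `g` is the dual of the bent function `f` on the `n`-dimensional space `∏ j, K j`
(`p` odd): `W_f(a) = ± p^(n/2) ζ_p^(g(a))` if `p ≡ 1 (mod 4)` or `n` is even, and
`W_f(a) = ± i p^(n/2) ζ_p^(g(a))` otherwise; the sign may depend on `a`. -/
def IsDual (n : ℕ) (f g : (∀ j, K j) → ZMod p) : Prop :=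
  ∀ a, ∃ σ : ℂ, (σ = 1 ∨ σ = -1) ∧
    walsh p f a = σ * (if p % 4 = 1 ∨ Even n then 1 else Complex.I) *
      (((p : ℝ) ^ ((n : ℝ) / 2) : ℝ) : ℂ) * ZMod.stdAddChar (g a)

/-- The bent function `f` is weakly regular, and `e` is the sign of its Walsh transform. -/
def IsWeaklyRegularWithSign (n : ℕ) (f : (∀ j, K j) → ZMod p) (e : ℂ) : Prop :=
  IsBent p n f ∧ (e = 1 ∨ e = -1 ∨ e = Complex.I ∨ e = -Complex.I) ∧
    ∃ g, IsDual p n f g ∧ ∀ a, walsh p f a =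
      e * (((p : ℝ) ^ ((n : ℝ) / 2) : ℝ) : ℂ) * ZMod.stdAddChar (g a)

variable {L : Type*} [Field L] [Fintype L] [DecidableEq L] [Algebra (ZMod p) L]

/-- The component function `F_c(x) = Tr(c F(x))`. -/
def component (F : (∀ j, K j) → L) (c : L) (x : ∀ j, K j) : ZMod p :=
  Algebra.trace (ZMod p) L (c * F x)

/-- `F` is vectorial bent: all its components `F_c`, `c ≠ 0`, are bent. -/
def IsVectorialBent (n : ℕ) (F : (∀ j, K j) → L) : Prop :=
  ∀ c : L, c ≠ 0 → IsBent p n (component p F c)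

/-- `F` is vectorial dual-bent, and `G` is a vectorial dual of `F`. -/
def IsVectorialDual (n : ℕ) (F G : (∀ j, K j) → L) : Prop :=
  IsVectorialBent p n F ∧ IsVectorialBent p n G ∧
    ∃ σ : Equiv.Perm {c : L // c ≠ 0}, ∀ c : {c : L // c ≠ 0},
      IsDual p n (component p F (c : L)) (component p G (σ c : L))

/-- The requirements of Condition II on the function `F : ∏ j, K j → L`, its vectorial dual
`Fs`, the exponents `l`, `d` and the constant `υ`; here `L` has `p ^ m` elements and `k` is the
common subfield of `L` and of all the `K j`. -/
structure ConditionII (k : Type*) [Field k] [∀ j, Algebra k (K j)] [Algebra k L]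
    (n m : ℕ) (l d : ℤ) (υ : ℂ) (F Fs : (∀ j, K j) → L) : Prop where
  vectorial_dual : IsVectorialDual p n F Fs
  gcd_eq : Int.gcd (d - 1) ((p : ℤ) ^ m - 1) = 1
  dual_component : ∀ c : L, c ≠ 0 →
    IsDual p n (component p F c) (component p Fs (c ^ (1 - d)))
  homogeneous : ∀ b : k, b ≠ 0 → ∀ x : ∀ j, K j,
    F (fun j => algebraMap k (K j) b * x j) = algebraMap k L b ^ l * F x
  map_zero : F 0 = 0
  exponents : (l - 1) * (d - 1) ≡ 1 [ZMOD (p : ℤ) ^ m - 1]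
  upsilon : υ = epsilon p ^ m ∨ υ = -epsilon p ^ m
  weakly_regular : ∀ c : L, c ≠ 0 →
    IsWeaklyRegularWithSign p n (component p F c) (υ * ((quadraticChar L c : ℤ) : ℂ))

/-- The hybrid character sum `S₂ = ∑ x, η(F(x)) χ₁(a x)`: `η` is the quadratic character of `L`
(with `η(0) = 0`), `χ₁` is the canonical additive character, and `a x` is the componentwise
product. -/
def hybridSum (F : (∀ j, K j) → L) (a : ∀ j, K j) : ℂ :=
  ∑ x, ((quadraticChar L (F x) : ℤ) : ℂ) * addChi p 1 (a * x)

end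

end HybridSum

end

/-! Let `G` be the quadratic Gauss sum of `L`, `χ` its canonical additive character, and `q = p ^
m`. Expanding `η(y) G = ∑ η(c) χ(c y)` at `y = F x` gives `S₂ G = ∑ η(c) W_{F_c}(-a)`. Since `l` is
even, `F` is even and `-a` may be replaced by `a`. Weak regularity then makes each term `υ p^(n/2)
χ(c^(1-d) F*(a))`, the two factors `η(c)` cancelling. As `c ↦ c^(1-d)` permutes the nonzero `c`, the
sum of these characters is `q - 1` or `-1`. Finally `G² = η(-1) q` allows `G` to be moved across
(`ConditionII.hybridSum_eq`).

What remains is the exact value of `G`, sign included (`quadGaussSum_eq`). Over the prime field it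
is Gauss's own argument: a q-binomial identity turns the sum into a product of sines
(`stdAddChar_sum_sq`). The passage to `L` is Hasse–Davenport, obtained by diagonalising the trace
form and computing its discriminant modulo squares (`sum_trace_sq`). -/

namespace HybridSum

/-! ### Gaussian binomials and Gauss's alternating sum -/

/-- The Gaussian binomial coefficient, defined by its Pascal recursion. -/
def gaussianBinom {R : Type*} [CommRing R] (q : R) : ℕ → ℕ → R
  | _, 0 => 1
  | 0, _ + 1 => 0
  | N + 1, j + 1 => gaussianBinom q N j + q ^ (j + 1) * gaussianBinom q N (j + 1)

section
variable {R : Type*} [CommRing R] (q : R)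

@[simp] theorem gaussianBinom_zero_right (N : ℕ) : gaussianBinom q N 0 = 1 := by
  cases N <;> rfl

@[simp] theorem gaussianBinom_zero_succ (j : ℕ) : gaussianBinom q 0 (j + 1) = 0 := rfl

theorem gaussianBinom_succ_succ (N j : ℕ) : gaussianBinom q (N + 1) (j + 1) =
    gaussianBinom q N j + q ^ (j + 1) * gaussianBinom q N (j + 1) := rfl

theorem gaussianBinom_eq_zero {N j : ℕ} (h : N < j) : gaussianBinom q N j = 0 := by
  induction N generalizing j with
  | zero => obtain ⟨j, rfl⟩ := Nat.exists_eq_succ_of_ne_zero h.ne'; rfl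
  | succ N ih =>
    obtain ⟨j, rfl⟩ := Nat.exists_eq_succ_of_ne_zero (Nat.ne_zero_of_lt h)
    rw [gaussianBinom_succ_succ, ih (by omega), ih (by omega)]; ring

/-- The second Pascal rule, whose usual coefficient is `q ^ (N - j)`; scaling by `q ^ j` avoids the
subtraction. -/
theorem pow_mul_gaussianBinom_succ_succ (N j : ℕ) : q ^ j * gaussianBinom q (N + 1) (j + 1) =
    q ^ N * gaussianBinom q N j + q ^ j * gaussianBinom q N (j + 1) := by
  induction N generalizing j with
  | zero => cases j <;> simp [gaussianBinom_succ_succ]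
  | succ N ih =>
    cases j with
    | zero =>
      have h := ih 0
      simp only [pow_zero, one_mul, zero_add, gaussianBinom_zero_right, mul_one,
        gaussianBinom_succ_succ q _ 0, pow_one] at h ⊢
      linear_combination q * h
    | succ j =>
      rw [gaussianBinom_succ_succ q (N + 1) (j + 1)]
      have h1 := ih j
      have h2 := ih (j + 1)
      have h3 := gaussianBinom_succ_succ q N j
      have h4 := gaussianBinom_succ_succ q N (j + 1)
      linear_combination q * h1 + q ^ (j + 2) * h2 - q ^ (N + 1) * h3 - q ^ (j + 1) * h4

theorem gaussianBinom_absorption (N j : ℕ) : (1 - q ^ (j + 1)) * gaussianBinom q (N + 1) (j + 1) =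
    (1 - q ^ (N + 1)) * gaussianBinom q N j := by
  linear_combination gaussianBinom_succ_succ q N j - q * pow_mul_gaussianBinom_succ_succ q N j

theorem gaussianBinom_step (N j : ℕ) :
    q ^ j * (1 - q ^ (j + 1)) * gaussianBinom q N (j + 1) =
      (q ^ j - q ^ N) * gaussianBinom q N j := by
  linear_combination q ^ j * gaussianBinom_succ_succ q N j - pow_mul_gaussianBinom_succ_succ q N j

/-- Pascal's rule turns the left side into `∑ (-1)^j (q^j - 1) [N+1, j]`, and absorption lowers each
term to `[N, j-1]`. -/
theorem alternating_sum_gaussianBinom_add_two (N : ℕ) :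
    ∑ j ∈ Finset.range (N + 3), (-1) ^ j * gaussianBinom q (N + 2) j =
      (1 - q ^ (N + 1)) * ∑ j ∈ Finset.range (N + 1), (-1) ^ j * gaussianBinom q N j := by
  have h1 : ∑ j ∈ Finset.range (N + 3), (-1) ^ j * gaussianBinom q (N + 2) j =
      ∑ j ∈ Finset.range (N + 3), (-1) ^ j * q ^ j * gaussianBinom q (N + 1) j -
        ∑ j ∈ Finset.range (N + 2), (-1) ^ j * gaussianBinom q (N + 1) j := by
    rw [Finset.sum_range_succ', Finset.sum_range_succ' _ (N + 2), add_sub_right_comm,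
      ← Finset.sum_sub_distrib]
    simp only [gaussianBinom_zero_right, pow_zero, mul_one]
    congr 1
    refine Finset.sum_congr rfl fun j _ => ?_
    rw [gaussianBinom_succ_succ]; ring
  have h2 : ∑ j ∈ Finset.range (N + 3), (-1) ^ j * q ^ j * gaussianBinom q (N + 1) j =
      ∑ j ∈ Finset.range (N + 2), (-1) ^ j * q ^ j * gaussianBinom q (N + 1) j := by
    rw [Finset.sum_range_succ, gaussianBinom_eq_zero q (by omega : N + 1 < N + 2)]; ring
  rw [h1, h2, ← Finset.sum_sub_distrib, Finset.sum_range_succ', Finset.mul_sum]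
  simp only [gaussianBinom_zero_right, pow_zero, mul_one, sub_self, add_zero]
  refine Finset.sum_congr rfl fun j _ => ?_
  linear_combination (-1) ^ j * gaussianBinom_absorption q N j

/-- Gauss's evaluation of the alternating sum of Gaussian binomial coefficients. -/
theorem alternating_sum_gaussianBinom (k : ℕ) :
    ∑ j ∈ Finset.range (2 * k + 1), (-1) ^ j * gaussianBinom q (2 * k) j =
      ∏ i ∈ Finset.range k, (1 - q ^ (2 * i + 1)) := by
  induction k with
  | zero => simp
  | succ k ih =>
    rw [Finset.prod_range_succ, ← ih, mul_comm _ (1 - q ^ (2 * k + 1))]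
    exact alternating_sum_gaussianBinom_add_two q (2 * k)

end

/-! ### The quadratic Gauss sum over the prime field -/

section
variable {K : Type*} [Field K] {w : K} {k : ℕ}

/-- With `Q = w⁻²` and `Q ^ (2k) = Q⁻¹`, the ratio of consecutive coefficients collapses to `-Q ^
(-(j+1)) = -w ^ (2(j+1))`. -/
theorem gaussianBinom_of_isPrimitiveRoot (hw : IsPrimitiveRoot w (2 * k + 1)) {j : ℕ}
    (hj : j ≤ 2 * k) : gaussianBinom (w⁻¹ ^ 2) (2 * k) j = (-1) ^ j * w ^ (j * (j + 1)) := by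
  have hw0 : w ≠ 0 := hw.ne_zero (by omega)
  have hq : IsPrimitiveRoot (w⁻¹ ^ 2) (2 * k + 1) :=
    hw.inv.pow_of_coprime 2 (by simp)
  induction j with
  | zero => simp
  | succ j ih =>
    have h := gaussianBinom_step (w⁻¹ ^ 2) (2 * k) j
    rw [ih (by omega)] at h
    have h1 : (w⁻¹ ^ 2) ^ (j + 1) ≠ 1 := hq.pow_ne_one_of_pos_of_lt (by omega) (by omega)
    have h2 : (w⁻¹ ^ 2) ^ (2 * k) = w ^ 2 := by
      have := hq.pow_eq_one
      rw [pow_succ] at this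
      rw [eq_comm, ← mul_left_inj' (pow_ne_zero 2 (inv_ne_zero hw0)), this, ← mul_pow,
        mul_inv_cancel₀ hw0, one_pow]
    rw [h2] at h
    have h3 : (w⁻¹ ^ 2) ^ (j + 1) * w ^ (2 * (j + 1)) = 1 := by
      rw [pow_mul, ← mul_pow, ← mul_pow, inv_mul_cancel₀ hw0]; simp
    have h4 : w⁻¹ ^ 2 * w ^ 2 = 1 := by rw [← mul_pow, inv_mul_cancel₀ hw0, one_pow]
    have h5 : (1 - (w⁻¹ ^ 2) ^ (j + 1)) ≠ 0 := sub_ne_zero.2 h1.symm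
    have h6 : (w⁻¹ ^ 2) ^ (j + 1) ≠ 0 := pow_ne_zero _ (pow_ne_zero _ (inv_ne_zero hw0))
    apply mul_left_cancel₀ (mul_ne_zero h6 h5)
    have e1 : w ^ ((j + 1) * (j + 1 + 1)) = w ^ (j * (j + 1)) * w ^ (2 * (j + 1)) := by
      rw [← pow_add]; congr 1; ring
    rw [e1]
    set Q := w⁻¹ ^ 2
    set W := w ^ (j * (j + 1))
    linear_combination Q * h - (-1) ^ j * W * h4 +
      (1 - Q ^ (j + 1)) * ((-1) ^ j * W) * h3

/-- Completes the square: `k² + j(j+1) ≡ (j+k+1)²` modulo `2k+1`. The factor `w ^ (k²)`, with `k²`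
the sum of the first `k` odd numbers, symmetrises the factors `1 - w ^ (-2(2i+1))` of Gauss's
product. -/
theorem sum_pow_sq_eq_prod (hw : IsPrimitiveRoot w (2 * k + 1)) :
    ∑ j ∈ Finset.range (2 * k + 1), w ^ ((j + (k + 1)) ^ 2) =
      ∏ i ∈ Finset.range k, (w ^ (2 * i + 1) - w⁻¹ ^ (2 * i + 1)) := by
  have hw0 : w ≠ 0 := hw.ne_zero (by omega)
  have h := alternating_sum_gaussianBinom (w⁻¹ ^ 2) k
  have hk : ∏ i ∈ Finset.range k, w ^ (2 * i + 1) = w ^ (k ^ 2) := by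
    rw [Finset.prod_pow_eq_pow_sum]
    congr 1
    clear h hw
    induction k with
    | zero => simp
    | succ k ih => rw [Finset.sum_range_succ, ih]; ring
  have hp := hw.pow_eq_one
  calc _ = w ^ (k ^ 2) * ∑ j ∈ Finset.range (2 * k + 1),
        (-1) ^ j * gaussianBinom (w⁻¹ ^ 2) (2 * k) j := by
        rw [Finset.mul_sum]
        refine Finset.sum_congr rfl fun j hj => ?_
        rw [gaussianBinom_of_isPrimitiveRoot hw (by simpa [Nat.lt_succ_iff] using hj),
          ← mul_assoc ((-1) ^ j), ← mul_pow, neg_one_mul, neg_neg, one_pow, one_mul, ← pow_add,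
          show (j + (k + 1)) ^ 2 = k ^ 2 + j * (j + 1) + (2 * k + 1) * (j + 1) by ring,
          pow_add _ (_ + _), pow_mul w (2 * k + 1), hp, one_pow, mul_one]
    _ = _ := by
        rw [h, ← hk, ← Finset.prod_mul_distrib]
        refine Finset.prod_congr rfl fun i _ => ?_
        have : w ^ (2 * i + 1) * w⁻¹ ^ (2 * i + 1) = 1 := by
          rw [← mul_pow, mul_inv_cancel₀ hw0, one_pow]
        rw [← pow_mul, mul_comm 2, pow_mul]
        linear_combination (- w⁻¹ ^ (2 * i + 1)) * this

end

/-- The angle lies in `(0, π)` when `2i < k` and in `(π, 2π)` otherwise, so exactly `k / 2` factors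
are negative. -/
theorem prod_two_mul_sin_pos (k : ℕ) :
    0 < (-1) ^ (k / 2) *
      ∏ i ∈ Finset.range k, (2 * Real.sin (2 * Real.pi * (2 * i + 1) / (2 * k + 1))) := by
  have hs : ∏ i ∈ Finset.range k, (if 2 * i < k then (1 : ℝ) else -1) = (-1) ^ (k / 2) := by
    rw [Finset.prod_ite, Finset.prod_const_one, one_mul, Finset.prod_const]
    congr 1
    rw [show (Finset.range k).filter (fun i => ¬ 2 * i < k) = Finset.Ico ((k + 1) / 2) k by
      ext i; simp only [Finset.mem_filter, Finset.mem_range, Finset.mem_Ico]; omega, Nat.card_Ico]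
    omega
  rw [← hs, ← Finset.prod_mul_distrib]
  refine Finset.prod_pos fun i hi => ?_
  rw [Finset.mem_range] at hi
  have hk : (0 : ℝ) < 2 * k + 1 := by positivity
  have hi' : (i : ℝ) + 1 ≤ k := by exact_mod_cast hi
  split_ifs with h
  · have h' : (2 * i : ℝ) + 1 ≤ k := by exact_mod_cast h
    have : 0 < Real.sin (2 * Real.pi * (2 * i + 1) / (2 * k + 1)) := by
      refine Real.sin_pos_of_pos_of_lt_pi (by positivity) ?_
      rw [div_lt_iff₀ hk]
      nlinarith [Real.pi_pos]
    linarith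
  · have h' : (k : ℝ) ≤ 2 * i := by exact_mod_cast not_lt.1 h
    have : 0 < Real.sin (2 * Real.pi * (2 * i + 1) / (2 * k + 1) - Real.pi) := by
      refine Real.sin_pos_of_pos_of_lt_pi ?_ ?_
      · rw [sub_pos, lt_div_iff₀ hk]; nlinarith [Real.pi_pos]
      · rw [sub_lt_iff_lt_add, div_lt_iff₀ hk]; nlinarith [Real.pi_pos]
    rw [Real.sin_sub_pi] at this
    linarith

/-- The quadratic Gauss sum as a sum over squares. -/
theorem gaussSum_quadraticChar_eq_sum_sq {L : Type*} [Field L] [Fintype L] [DecidableEq L]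
    (hL : ringChar L ≠ 2) {ψ : AddChar L ℂ} (hψ : ψ ≠ 1) :
    gaussSum ((quadraticChar L).ringHomComp (Int.castRingHom ℂ)) ψ = ∑ x, ψ (x ^ 2) := by
  have h1 : ∑ x, ψ (x ^ 2) =
      ∑ y, (((Finset.univ.filter fun x : L => x ^ 2 = y).card : ℕ) : ℂ) * ψ y := by
    rw [← Finset.sum_fiberwise Finset.univ (fun x : L => x ^ 2)]
    refine Finset.sum_congr rfl fun y _ => ?_
    rw [Finset.sum_congr rfl (g := fun _ => ψ y)
      (fun x hx => by rw [(Finset.mem_filter.1 hx).2]), Finset.sum_const, nsmul_eq_mul]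
  have h2 : ∀ y : L, (((Finset.univ.filter fun x : L => x ^ 2 = y).card : ℕ) : ℂ) =
      ((quadraticChar L y : ℤ) : ℂ) + 1 := fun y => by
    have := quadraticChar_card_sqrts hL y
    rw [← Int.cast_one, ← Int.cast_add, ← this, Int.cast_natCast]
    congr 2
    ext; simp
  rw [h1]
  simp_rw [h2, add_mul, one_mul]
  rw [Finset.sum_add_distrib, AddChar.sum_eq_zero_of_ne_one hψ, add_zero]
  rfl

/-- With `p = 2k+1` the sum is `I ^ k * r` for a real product of sines `r`. The general formula for
the square of a Gauss sum gives `r² = p`; counting negative sines gives the sign of `r`. -/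
theorem stdAddChar_sum_sq (p : ℕ) [Fact p.Prime] (hp : p ≠ 2) :
    ∑ x : ZMod p, (ZMod.stdAddChar (x ^ 2) : ℂ) = epsilon p * (Real.sqrt p : ℂ) := by
  have hodd : Odd p := (Fact.out : p.Prime).odd_of_ne_two hp
  obtain ⟨k, hk⟩ := hodd
  have hp0 : p ≠ 0 := by omega
  set w : ℂ := Complex.exp (2 * Real.pi * Complex.I / p) with hw
  have hwp : IsPrimitiveRoot w (2 * k + 1) := by
    rw [← hk]; exact Complex.isPrimitiveRoot_exp p hp0
  have hchar : ∀ j : ℕ, (ZMod.stdAddChar (j : ZMod p) : ℂ) = w ^ j := fun j => by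
    have := ZMod.stdAddChar_coe (N := p) j
    rw [Int.cast_natCast] at this
    rw [this, hw, ← Complex.exp_nat_mul]
    congr 1
    push_cast; ring
  have h1 : ∑ x : ZMod p, (ZMod.stdAddChar (x ^ 2) : ℂ) =
      ∑ j ∈ Finset.range (2 * k + 1), w ^ ((j + (k + 1)) ^ 2) := by
    -- Translation by `k + 1` matches the shift produced by completing the square.
    rw [← Equiv.sum_comp (Equiv.addRight ((k + 1 : ℕ) : ZMod p)), ← hk]
    symm
    refine Finset.sum_bij' (fun j _ => (j : ZMod p)) (fun x _ => x.val) (by simp)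
      (fun x _ => Finset.mem_range.2 (ZMod.val_lt x))
      (fun j hj => ZMod.val_cast_of_lt (Finset.mem_range.1 hj)) (fun x _ => ZMod.natCast_zmod_val x)
      fun j _ => ?_
    rw [← hchar]
    simp [add_assoc]
  set r : ℝ := ∏ i ∈ Finset.range k, (2 * Real.sin (2 * Real.pi * (2 * i + 1) / (2 * k + 1)))
    with hr
  have h2 : ∑ x : ZMod p, (ZMod.stdAddChar (x ^ 2) : ℂ) = Complex.I ^ k * r := by
    rw [h1, sum_pow_sq_eq_prod hwp, hr, Complex.ofReal_prod]
    conv_rhs => rw [← Finset.card_range k, ← Finset.prod_const]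
    rw [Finset.card_range, ← Finset.prod_mul_distrib]
    refine Finset.prod_congr rfl fun i _ => ?_
    have e : w ^ (2 * i + 1) = Complex.exp
        (((2 * Real.pi * (2 * i + 1) / (2 * k + 1) : ℝ) : ℂ) * Complex.I) := by
      rw [hw, ← Complex.exp_nat_mul, hk]
      congr 1
      push_cast; ring
    rw [inv_pow, e, ← Complex.exp_neg, ← neg_mul, ← Complex.ofReal_neg, Complex.exp_mul_I,
      Complex.exp_mul_I, ← Complex.ofReal_sin, ← Complex.ofReal_cos, ← Complex.ofReal_sin,
      ← Complex.ofReal_cos, Real.sin_neg, Real.cos_neg]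
    push_cast; ring
  have hrc : ringChar (ZMod p) ≠ 2 := by rwa [ZMod.ringChar_zmod_n]
  have hprim : (ZMod.stdAddChar (N := p)).IsPrimitive := ZMod.isPrimitive_stdAddChar p
  have hψ : (ZMod.stdAddChar (N := p)) ≠ 1 := by
    intro h
    have := hprim one_ne_zero
    rw [h] at this
    exact this (by ext; simp)
  have hn : ‖Complex.I ^ k * (r : ℂ)‖ ^ 2 = p := by
    have h3 := gaussSum_sq (χ := (quadraticChar (ZMod p)).ringHomComp (Int.castRingHom ℂ))
      ((MulChar.ringHomComp_ne_one_iff (RingHom.injective_int _)).mpr (quadraticChar_ne_one hrc))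
      ((quadraticChar_isQuadratic _).comp _) hprim
    rw [gaussSum_quadraticChar_eq_sum_sq hrc hψ, h2] at h3
    rw [← norm_pow, h3, norm_mul, ZMod.card, Complex.norm_natCast]
    rcases quadraticChar_dichotomy (neg_ne_zero.2 (one_ne_zero (α := ZMod p))) with h | h <;>
      simp [MulChar.ringHomComp_apply, h]
  have hr2 : r ^ 2 = p := by
    simpa using hn
  have hpos := prod_two_mul_sin_pos k
  rw [← hr] at hpos
  have hrs : r = (-1) ^ (k / 2) * Real.sqrt p := by
    have : (-1) ^ (k / 2) * r = Real.sqrt p := by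
      rw [eq_comm, Real.sqrt_eq_iff_mul_self_eq (by positivity) hpos.le, ← sq, mul_pow, hr2,
        ← pow_mul, mul_comm _ 2, pow_mul]
      simp
    rw [← this, ← mul_assoc, ← mul_pow]; simp
  rw [h2, hrs]
  push_cast
  rw [← mul_assoc]
  congr 1
  rcases Nat.even_or_odd' k with ⟨i, rfl | rfl⟩
  · rw [epsilon_of_mod_four_eq_one (by omega), pow_mul, Complex.I_sq,
      Nat.mul_div_cancel_left _ two_pos, ← mul_pow]
    simp
  · rw [epsilon_of_mod_four_eq_three (by omega), pow_succ, pow_mul, Complex.I_sq,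
      show (2 * i + 1) / 2 = i by omega, mul_right_comm, ← mul_pow]
    simp


/-! ### Discriminant of the trace form and Hasse–Davenport -/

section
variable {k L : Type*} [Field k] [Fintype k] [Field L] [Fintype L] [Algebra k L]

theorem sum_mul_sq [DecidableEq k] {ψ : AddChar k ℂ} (hk : ringChar k ≠ 2) (hψ : ψ ≠ 1) {a : k}
    (ha : a ≠ 0) :
    ∑ y, ψ (a * y ^ 2) = ((quadraticChar k a : ℤ) : ℂ) * ∑ y, ψ (y ^ 2) := by
  have hψa : ψ.mulShift a ≠ 1 := AddChar.IsPrimitive.of_ne_one hψ ha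
  have h := gaussSum_mulShift ((quadraticChar k).ringHomComp (Int.castRingHom ℂ)) ψ (Units.mk0 a ha)
  rw [Units.val_mk0, gaussSum_quadraticChar_eq_sum_sq hk hψ,
    gaussSum_quadraticChar_eq_sum_sq hk hψa] at h
  rw [← h, ← mul_assoc]
  have h1 : ((quadraticChar k a : ℤ) : ℂ) * ((quadraticChar k a : ℤ) : ℂ) = 1 := by
    rw [← Int.cast_mul, ← sq, quadraticChar_sq_one ha, Int.cast_one]
  rw [MulChar.ringHomComp_apply, Int.coe_castRingHom, h1, one_mul]
  rfl

/-- The matrix of all conjugates of a family of elements of a finite field. -/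
def conjMatrix (k : Type*) {L : Type*} [Field L] [Fintype k] {m : ℕ} (v : Fin m → L) :
    Matrix (Fin m) (Fin m) L := Matrix.of fun i j => v j ^ Fintype.card k ^ (i : ℕ)

theorem algebraMap_discr_eq_det_conjMatrix_sq (v : Fin (Module.finrank k L) → L) :
    algebraMap k L (Algebra.discr k v) = (conjMatrix k v).det ^ 2 := by
  rw [Algebra.discr_def, RingHom.map_det, sq]
  nth_rewrite 1 [← Matrix.det_transpose (conjMatrix k v)]
  rw [← Matrix.det_mul]
  congr 1
  ext i j
  rw [RingHom.mapMatrix_apply, Matrix.map_apply, Algebra.traceMatrix_apply, Algebra.traceForm_apply,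
    FiniteField.algebraMap_trace_eq_sum_pow, Matrix.mul_apply, Finset.sum_range]
  simp [conjMatrix, mul_pow, Nat.card_eq_fintype_card]

/-- Frobenius shifts the rows of the conjugate matrix cyclically, the last wrapping round because `x
^ |L| = x`; a full cycle on `m` rows has sign `(-1) ^ (m - 1)`. -/
theorem det_conjMatrix_pow_card (v : Fin (Module.finrank k L) → L) :
    (conjMatrix k v).det ^ Fintype.card k =
      (-1) ^ (Module.finrank k L - 1) * (conjMatrix k v).det := by
  have h : (conjMatrix k v).map (FiniteField.frobeniusAlgHom k L) =
      (conjMatrix k v).submatrix (finRotate (Module.finrank k L)) id := by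
    have hpos : 0 < Module.finrank k L := Module.finrank_pos
    have hcard : Fintype.card L = Fintype.card k ^ Module.finrank k L := Module.card_eq_pow_finrank
    generalize Module.finrank k L = m at *
    obtain ⟨m, rfl⟩ := Nat.exists_eq_succ_of_ne_zero hpos.ne'
    ext i j
    simp only [conjMatrix, Matrix.map_apply, Matrix.of_apply, Matrix.submatrix_apply, id_eq,
      FiniteField.coe_frobeniusAlgHom]
    rw [← pow_mul, ← pow_succ]
    rcases eq_or_ne i (Fin.last m) with rfl | hi
    · rw [finRotate_last, Fin.val_last, ← hcard, FiniteField.pow_card]; simp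
    · rw [coe_finRotate_of_ne_last hi]
  have h2 := congrArg Matrix.det h
  rw [Matrix.det_permute, sign_finRotate] at h2
  have h3 := (AlgHom.map_det (FiniteField.frobeniusAlgHom k L) (conjMatrix k v))
  rw [AlgHom.mapMatrix_apply, h2, FiniteField.coe_frobeniusAlgHom] at h3
  refine h3.trans ?_
  simp

/-- The discriminant is `δ²`, so it is a square in `k` exactly when `δ` lies in `k`, that is, when
Frobenius fixes `δ`. Frobenius multiplies `δ` by `(-1) ^ (m - 1)`, with `m` the degree. -/
theorem quadraticChar_discr [DecidableEq k] (hk : ringChar k ≠ 2)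
    (v : Module.Basis (Fin (Module.finrank k L)) k L) :
    quadraticChar k (Algebra.discr k v) = (-1) ^ (Module.finrank k L - 1) := by
  have hD := Algebra.discr_not_zero_of_basis k v
  have hsq := algebraMap_discr_eq_det_conjMatrix_sq (k := k) (v : _ → L)
  have hfr := det_conjMatrix_pow_card (k := k) (v : _ → L)
  set δ := (conjMatrix k (v : _ → L)).det
  have hδ : δ ≠ 0 := by
    intro h
    rw [h, sq, zero_mul, map_eq_zero] at hsq
    exact hD hsq
  have hL2 : (2 : L) ≠ 0 := by
    have := (algebraMap k L).injective.ne (Ring.two_ne_zero hk)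
    rwa [map_ofNat, map_zero] at this
  rcases Nat.even_or_odd (Module.finrank k L - 1) with he | ho
  · rw [he.neg_one_pow] at hfr ⊢
    rw [one_mul] at hfr
    rw [quadraticChar_one_iff_isSquare hD]
    obtain ⟨e, he⟩ : δ ∈ Set.range (algebraMap k L) := by
      rw [IsGalois.mem_range_algebraMap_iff_fixed]
      intro f
      obtain ⟨n, rfl⟩ := (FiniteField.bijective_frobeniusAlgEquivOfAlgebraic_pow k L).2 f
      rw [AlgEquiv.coe_pow, FiniteField.coe_frobeniusAlgEquivOfAlgebraic_iterate]
      generalize (n : ℕ) = n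
      induction n with
      | zero => simp
      | succ n ih =>
        change δ ^ _ = δ at ih ⊢
        rw [pow_succ, pow_mul, ih, hfr]
    refine ⟨e, (algebraMap k L).injective ?_⟩
    rw [hsq, map_mul, he, sq]
  · rw [ho.neg_one_pow] at hfr ⊢
    rw [quadraticChar_neg_one_iff_not_isSquare]
    rintro ⟨e, he⟩
    rw [he, map_mul, ← sq] at hsq
    have hfix : (algebraMap k L e) ^ Fintype.card k = algebraMap k L e := by
      rw [← map_pow, FiniteField.pow_card]
    have : δ ^ Fintype.card k = δ := by
      rcases sq_eq_sq_iff_eq_or_eq_neg.1 hsq with h | h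
      · rw [← h, hfix]
      · rw [← neg_eq_iff_eq_neg] at h
        rw [← h, Odd.neg_pow, hfix]
        rw [← Nat.not_even_iff_odd, Nat.even_iff]
        exact fun h => hk (FiniteField.even_card_iff_char_two.2 h)
    rw [this] at hfr
    apply mul_ne_zero hL2 hδ
    linear_combination hfr

/-- The Hasse–Davenport relation for the quadratic Gauss sum. -/
theorem sum_trace_sq {ψ : AddChar k ℂ} (hk : ringChar k ≠ 2) (hψ : ψ ≠ 1) :
    ∑ x : L, ψ (Algebra.trace k L (x ^ 2)) =
      (-1) ^ (Module.finrank k L - 1) * (∑ y, ψ (y ^ 2)) ^ Module.finrank k L := by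
  classical
  have h2 : (2 : k) ≠ 0 := Ring.two_ne_zero hk
  let _ : Invertible (2 : k) := invertibleOfNonzero h2
  -- In an orthogonal basis for the trace form the sum splits into one-variable Gauss sums, and the
  -- product of their quadratic characters is that of the discriminant.
  obtain ⟨v, hv⟩ := LinearMap.BilinForm.exists_orthogonal_basis (B := Algebra.traceForm k L)
    ⟨fun x y => (Algebra.traceForm_isSymm k).eq x y⟩
  have hv' : ∀ i j, i ≠ j → Algebra.trace k L (v i * v j) = 0 := fun i j hij => hv hij
  have hdiscr : Algebra.discr k v = ∏ i, Algebra.trace k L (v i * v i) := by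
    rw [Algebra.discr_def, ← Matrix.det_diagonal]
    congr 1
    ext i j
    rw [Algebra.traceMatrix_apply, Algebra.traceForm_apply, Matrix.diagonal_apply]
    split_ifs with h
    · rw [h]
    · exact hv' i j h
  have hne : ∀ i, Algebra.trace k L (v i * v i) ≠ 0 := fun i => by
    have := Algebra.discr_not_zero_of_basis k v
    rw [hdiscr, Finset.prod_ne_zero_iff] at this
    exact this i (Finset.mem_univ i)
  have hform : ∀ c : Fin (Module.finrank k L) → k,
      Algebra.trace k L ((∑ i, c i • v i) ^ 2) =
        ∑ i, Algebra.trace k L (v i * v i) * c i ^ 2 := fun c => by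
    rw [sq, Finset.sum_mul_sum, map_sum]
    refine Finset.sum_congr rfl fun i _ => ?_
    rw [map_sum, Finset.sum_eq_single i]
    · rw [smul_mul_smul_comm, map_smul, smul_eq_mul]; ring
    · intro j _ hj
      rw [smul_mul_smul_comm, map_smul, hv' i j hj.symm, smul_zero]
    · simp
  have hprod : ∀ g : Fin (Module.finrank k L) → k, ψ (∑ i, g i) = ∏ i, ψ (g i) := fun g => by
    have := map_prod ψ.toMonoidHom (fun i => Multiplicative.ofAdd (g i)) Finset.univ
    rwa [← ofAdd_sum] at this
  rw [← Equiv.sum_comp v.equivFun.symm.toEquiv]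
  simp only [LinearEquiv.coe_toEquiv, Module.Basis.equivFun_symm_apply, hform]
  simp_rw [hprod]
  rw [← Fintype.prod_sum fun i y => ψ (Algebra.trace k L (v i * v i) * y ^ 2)]
  simp_rw [sum_mul_sq hk hψ (hne _)]
  rw [Finset.prod_mul_distrib, Finset.prod_const, Finset.card_univ, Fintype.card_fin,
    ← Int.cast_prod, ← map_prod, ← hdiscr, quadraticChar_discr hk]
  simp

end


/-! ### Power permutations and Gauss sums on `L` -/

/-- Since `(1-d)(1-l) ≡ 1` modulo the order of the unit group, `c ↦ c^(1-l)` inverts `c ↦ c^(1-d)`.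
-/
theorem sum_zpow_eq_sum {p m : ℕ} {L : Type*} [Field L] [Fintype L] [DecidableEq L]
    (hL : Fintype.card L = p ^ m) {l d : ℤ}
    (hld : (l - 1) * (d - 1) ≡ 1 [ZMOD (p : ℤ) ^ m - 1]) (f : L → ℂ) :
    ∑ c ∈ Finset.univ.erase 0, f (c ^ (1 - d)) = ∑ c ∈ Finset.univ.erase 0, f c := by
  have key : ∀ c : L, c ≠ 0 → c ^ ((1 - d) * (1 - l)) = c := fun c hc => by
    obtain ⟨z, hz⟩ := hld.dvd
    have hz' : (1 - d) * (1 - l) = 1 + ((p : ℤ) ^ m - 1) * -z := by linear_combination -hz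
    have h1 : c ^ ((p : ℤ) ^ m - 1) = 1 := by
      rw [zpow_sub_one₀ hc, ← Nat.cast_pow, zpow_natCast, ← hL, FiniteField.pow_card,
        mul_inv_cancel₀ hc]
    rw [hz', zpow_add₀ hc, zpow_one, zpow_mul, h1, one_zpow, mul_one]
  refine Finset.sum_nbij' (fun c => c ^ (1 - d)) (fun c => c ^ (1 - l)) ?_ ?_ ?_ ?_ fun _ _ => rfl
  · intro c hc; simpa using zpow_ne_zero _ (by simpa using hc)
  · intro c hc; simpa using zpow_ne_zero _ (by simpa using hc)
  · intro c hc
    rw [← zpow_mul, key c (by simpa using hc)]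
  · intro c hc
    rw [← zpow_mul, mul_comm, key c (by simpa using hc)]

section
variable (p : ℕ) [Fact p.Prime] (L : Type*) [Field L] [Algebra (ZMod p) L]

/-- The canonical additive character `x ↦ ζ_p ^ Tr(x)` of a finite field. -/
noncomputable def traceChar : AddChar L ℂ :=
  (ZMod.stdAddChar (N := p)).compAddMonoidHom (Algebra.trace (ZMod p) L).toAddMonoidHom

variable {L}

theorem traceChar_apply (x : L) :
    traceChar p L x = ZMod.stdAddChar (Algebra.trace (ZMod p) L x) := rfl

variable (L)

theorem traceChar_ne_one [Finite L] : traceChar p L ≠ 1 := by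
  intro h
  obtain ⟨x, hx⟩ := Algebra.trace_surjective (ZMod p) L 1
  have h1 : traceChar p L x = 1 := by rw [h]; rfl
  rw [traceChar_apply, hx, ← AddChar.map_zero_eq_one (ZMod.stdAddChar (N := p))] at h1
  exact one_ne_zero (ZMod.injective_stdAddChar h1)

theorem stdAddChar_ne_one : ZMod.stdAddChar (N := p) ≠ 1 := by
  intro h
  have h1 : (ZMod.stdAddChar (1 : ZMod p) : ℂ) = 1 := by rw [h]; rfl
  rw [← AddChar.map_zero_eq_one (ZMod.stdAddChar (N := p))] at h1
  exact one_ne_zero (ZMod.injective_stdAddChar h1)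

/-- The Gauss sum of the quadratic character and the canonical additive character of `L`. -/
noncomputable def quadGaussSum [Fintype L] [DecidableEq L] : ℂ :=
  gaussSum ((quadraticChar L).ringHomComp (Int.castRingHom ℂ)) (traceChar p L)

variable {p L}

theorem ringChar_ne_two (hp : p ≠ 2) : ringChar L ≠ 2 := by
  have := charP_of_injective_algebraMap (algebraMap (ZMod p) L).injective p
  rwa [ringChar.eq L p]

theorem finrank_eq_of_card [Fintype L] {m : ℕ} (hL : Fintype.card L = p ^ m) :
    Module.finrank (ZMod p) L = m := by
  have h := Module.card_eq_pow_finrank (K := ZMod p) (V := L)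
  rw [hL, ZMod.card] at h
  exact (Nat.pow_right_injective (Fact.out : p.Prime).two_le h).symm

variable [Fintype L] [DecidableEq L]

theorem quadGaussSum_eq (hp : p ≠ 2) {m : ℕ} (hL : Fintype.card L = p ^ m) :
    quadGaussSum p L = (-1) ^ (m - 1) * epsilon p ^ m * ((Real.sqrt ((p : ℝ) ^ m) : ℝ) : ℂ) := by
  have hk : ringChar (ZMod p) ≠ 2 := by rwa [ZMod.ringChar_zmod_n]
  have hs : Real.sqrt ((p : ℝ) ^ m) = Real.sqrt p ^ m := by
    rw [Real.sqrt_eq_iff_mul_self_eq (by positivity) (by positivity), ← mul_pow,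
      Real.mul_self_sqrt (by positivity)]
  rw [quadGaussSum, gaussSum_quadraticChar_eq_sum_sq (ringChar_ne_two hp) (traceChar_ne_one p L)]
  simp_rw [traceChar_apply]
  rw [sum_trace_sq hk (stdAddChar_ne_one p), stdAddChar_sum_sq p hp, finrank_eq_of_card hL,
    mul_pow, hs]
  push_cast
  ring

theorem quadGaussSum_sq (hp : p ≠ 2) {m : ℕ} (hL : Fintype.card L = p ^ m) :
    quadGaussSum p L ^ 2 = ((quadraticChar L (-1) : ℤ) : ℂ) * (p : ℂ) ^ m := by
  rw [quadGaussSum, gaussSum_sq ((MulChar.ringHomComp_ne_one_iff (RingHom.injective_int _)).mpr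
    (quadraticChar_ne_one (ringChar_ne_two (p := p) hp))) ((quadraticChar_isQuadratic _).comp _)
    (AddChar.IsPrimitive.of_ne_one (traceChar_ne_one p L)), hL]
  simp [MulChar.ringHomComp_apply]

/-- Valid also at `y = 0`, where the right side is the full sum of a nontrivial character. -/
theorem quadraticChar_mul_quadGaussSum (hp : p ≠ 2) (y : L) :
    ((quadraticChar L y : ℤ) : ℂ) * quadGaussSum p L =
      ∑ c, ((quadraticChar L c : ℤ) : ℂ) * traceChar p L (c * y) := by
  rcases eq_or_ne y 0 with rfl | hy
  · simp only [mul_zero, AddChar.map_zero_eq_one, mul_one, quadraticChar_zero, Int.cast_zero,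
      zero_mul]
    rw [← Int.cast_sum, quadraticChar_sum_zero (ringChar_ne_two (p := p) hp), Int.cast_zero]
  · have h := gaussSum_mulShift ((quadraticChar L).ringHomComp (Int.castRingHom ℂ))
      (traceChar p L) (Units.mk0 y hy)
    rw [Units.val_mk0, MulChar.ringHomComp_apply, Int.coe_castRingHom] at h
    rw [quadGaussSum, ← h, ← mul_assoc, ← Int.cast_mul, ← sq, quadraticChar_sq_one hy,
      Int.cast_one, one_mul]
    simp [gaussSum, mul_comm, AddChar.mulShift_apply]

theorem sum_traceChar_mul {m : ℕ} (hL : Fintype.card L = p ^ m) (y : L) :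
    ∑ c ∈ Finset.univ.erase 0, traceChar p L (c * y) =
      if y = 0 then (p : ℂ) ^ m - 1 else -1 := by
  have h := AddChar.sum_mulShift y (AddChar.IsPrimitive.of_ne_one (traceChar_ne_one p L))
  rw [Finset.sum_erase_eq_sub (Finset.mem_univ _), h, hL, zero_mul, AddChar.map_zero_eq_one]
  split_ifs <;> simp

end

/-! ### Walsh transforms under Condition II and the hybrid sum -/

section
variable {p : ℕ} [Fact p.Prime] {s : ℕ} {K : Fin s → Type*} [∀ j, Field (K j)]
  [∀ j, Fintype (K j)] [∀ j, Algebra (ZMod p) (K j)]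

theorem stdAddChar_ne_neg (hp : p ≠ 2) (x y : ZMod p) :
    (ZMod.stdAddChar x : ℂ) ≠ -ZMod.stdAddChar y := by
  intro h
  have hodd : Odd p := (Fact.out : p.Prime).odd_of_ne_two hp
  have hpow : ∀ z : ZMod p, (ZMod.stdAddChar z : ℂ) ^ p = 1 := fun z => by
    rw [← AddChar.map_nsmul_eq_pow]; simp
  have h1 := congrArg (· ^ p) h
  simp only [hodd.neg_pow, hpow] at h1
  norm_num at h1

/-- Identifies the dual supplied by weak regularity with the component of the vectorial dual. The
undetermined sign is harmless: for odd `p`, `-1` is not a ratio of `p`-th roots of unity. -/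
theorem IsDual.unique (hp : p ≠ 2) {n : ℕ} {f g g' : (∀ j, K j) → ZMod p} (h : IsDual p n f g)
    (h' : IsDual p n f g') : g = g' := by
  funext a
  obtain ⟨σ, hσ, e⟩ := h a
  obtain ⟨σ', hσ', e'⟩ := h' a
  have hp0 : (((p : ℝ) ^ ((n : ℝ) / 2) : ℝ) : ℂ) ≠ 0 := by
    have : (0 : ℝ) < p := by exact_mod_cast (Fact.out : p.Prime).pos
    exact_mod_cast (Real.rpow_pos_of_pos this _).ne'
  have hI : (if p % 4 = 1 ∨ Even n then 1 else Complex.I) ≠ 0 := by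
    split_ifs <;> simp
  have e2 : σ * ZMod.stdAddChar (g a) = σ' * ZMod.stdAddChar (g' a) := by
    apply mul_left_cancel₀ (mul_ne_zero hI hp0)
    linear_combination e' - e
  rcases hσ with rfl | rfl <;> rcases hσ' with rfl | rfl
  · exact ZMod.injective_stdAddChar (by simpa using e2)
  · exact absurd (by simpa using e2) (stdAddChar_ne_neg hp (g a) (g' a))
  · exact absurd (by simpa using e2.symm) (stdAddChar_ne_neg hp (g' a) (g a))
  · exact ZMod.injective_stdAddChar (by simpa using e2)

variable {L : Type*} [Field L] [Fintype L] [DecidableEq L] [Algebra (ZMod p) L]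
  {k : Type*} [Field k] [∀ j, Algebra k (K j)] [Algebra k L] {n m : ℕ} {l d : ℤ} {υ : ℂ}
  {F Fs : (∀ j, K j) → L}

theorem ConditionII.walsh_component (hF : ConditionII p k n m l d υ F Fs) (hp : p ≠ 2) {c : L}
    (hc : c ≠ 0) (a : ∀ j, K j) : walsh p (component p F c) a =
      υ * ((quadraticChar L c : ℤ) : ℂ) * (((p : ℝ) ^ ((n : ℝ) / 2) : ℝ) : ℂ) *
        traceChar p L (c ^ (1 - d) * Fs a) := by
  obtain ⟨-, -, g, hg, hw⟩ := hF.weakly_regular c hc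
  rw [hw a, hg.unique hp (hF.dual_component c hc)]
  rfl

/-- As `p ^ m - 1` is even, `(l-1)(d-1)` is odd, so `l` is even; homogeneity is then applied at `b =
-1`. -/
theorem ConditionII.map_neg (hF : ConditionII p k n m l d υ F Fs) (hp : p ≠ 2)
    (x : ∀ j, K j) : F (-x) = F x := by
  have h := hF.homogeneous (-1) (by simp) x
  have hx : (fun j => algebraMap k (K j) (-1) * x j) = -x := by
    funext j; simp
  have hodd : Odd p := (Fact.out : p.Prime).odd_of_ne_two hp
  have hq : Even ((p : ℤ) ^ m - 1) := ((Int.odd_coe_nat p).2 hodd).pow.sub_odd odd_one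
  have hl : Even l := by
    obtain ⟨z, hz⟩ := hF.exponents.dvd
    have h1 : Odd ((l - 1) * (d - 1)) := by
      rw [show (l - 1) * (d - 1) = 1 - ((p : ℤ) ^ m - 1) * z by linear_combination -hz]
      exact odd_one.sub_even (hq.mul_right z)
    have h2 := (Int.odd_mul.1 h1).1
    simpa using h2.add_odd odd_one
  rw [hx] at h
  rw [h, _root_.map_neg, map_one, hl.neg_one_zpow, one_mul]

theorem ConditionII.walsh_component_neg (hF : ConditionII p k n m l d υ F Fs) (hp : p ≠ 2)
    (c : L) (a : ∀ j, K j) :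
    walsh p (component p F c) (-a) = walsh p (component p F c) a := by
  rw [walsh, ← Equiv.sum_comp (Equiv.neg _)]
  refine Finset.sum_congr rfl fun x _ => ?_
  simp [component, innerProd, hF.map_neg hp]

/-- The argument is `-a` because the Walsh transform carries `-⟨a, x⟩` and the hybrid sum `+⟨a, x⟩`.
-/
theorem hybridSum_mul_quadGaussSum (hp : p ≠ 2) (F : (∀ j, K j) → L) (a : ∀ j, K j) :
    hybridSum p F a * quadGaussSum p L =
      ∑ c, ((quadraticChar L c : ℤ) : ℂ) * walsh p (component p F c) (-a) := by
  simp_rw [hybridSum, Finset.sum_mul, walsh, Finset.mul_sum]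
  rw [Finset.sum_comm]
  refine Finset.sum_congr rfl fun x _ => ?_
  rw [mul_right_comm, quadraticChar_mul_quadGaussSum hp, Finset.sum_mul]
  refine Finset.sum_congr rfl fun c _ => ?_
  rw [mul_assoc, traceChar_apply, addChi, ← AddChar.map_add_eq_mul]
  simp [component, innerProd]

theorem ConditionII.hybridSum_eq (hF : ConditionII p k n m l d υ F Fs) (hp : p ≠ 2)
    (hL : Fintype.card L = p ^ m) (a : ∀ j, K j) :
    hybridSum p F a = (if Fs a = 0 then (p : ℂ) ^ m - 1 else -1) / (p : ℂ) ^ m * υ *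
      (((p : ℝ) ^ ((n : ℝ) / 2) : ℝ) : ℂ) * quadGaussSum p L *
        ((quadraticChar L (-1) : ℤ) : ℂ) := by
  have hsum : hybridSum p F a * quadGaussSum p L =
      υ * (((p : ℝ) ^ ((n : ℝ) / 2) : ℝ) : ℂ) *
        if Fs a = 0 then (p : ℂ) ^ m - 1 else -1 := by
    rw [hybridSum_mul_quadGaussSum hp, ← sum_traceChar_mul hL,
      ← sum_zpow_eq_sum hL hF.exponents fun c => traceChar p L (c * Fs a), Finset.mul_sum,
      ← Finset.sum_erase (a := (0 : L)) _ (by simp)]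
    refine Finset.sum_congr rfl fun c hc => ?_
    have hc0 : c ≠ 0 := by simpa using hc
    have hsq : ((quadraticChar L c : ℤ) : ℂ) * ((quadraticChar L c : ℤ) : ℂ) = 1 := by
      rw [← Int.cast_mul, ← sq, quadraticChar_sq_one hc0, Int.cast_one]
    rw [hF.walsh_component_neg hp, hF.walsh_component hp hc0]
    linear_combination (υ * (((p : ℝ) ^ ((n : ℝ) / 2) : ℝ) : ℂ) *
      traceChar p L (c ^ (1 - d) * Fs a)) * hsq
  have hη : ((quadraticChar L (-1) : ℤ) : ℂ) * ((quadraticChar L (-1) : ℤ) : ℂ) = 1 := by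
    rw [← Int.cast_mul, ← sq, quadraticChar_sq_one (neg_ne_zero.2 one_ne_zero), Int.cast_one]
  have hq : (p : ℂ) ^ m ≠ 0 :=
    pow_ne_zero _ (Nat.cast_ne_zero.2 (Fact.out : p.Prime).ne_zero)
  have hG := quadGaussSum_sq (L := L) hp hL
  generalize (if Fs a = 0 then (p : ℂ) ^ m - 1 else -1) = N at *
  field_simp
  -- Instead of dividing by `G`, multiply the identity for `S₂ G` by `G η(-1)` and use `G² = η(-1)
  -- q`.
  linear_combination quadGaussSum p L * ((quadraticChar L (-1) : ℤ) : ℂ) * hsum -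
    hybridSum p F a * ((quadraticChar L (-1) : ℤ) : ℂ) * hG - hybridSum p F a * (p : ℂ) ^ m * hη

end

end HybridSum

theorem theorem3 (p : ℕ) [Fact p.Prime] (hp : p ≠ 2)
    (s n m t : ℕ) (nj : Fin s → ℕ)
    (hm : 0 < m) (ht : 0 < t) (hnj : ∀ j, 0 < nj j)
    (hn : n = ∑ j, nj j) (htn : ∀ j, t ∣ nj j) (htm : t ∣ m)
    (hnm : 3 * m ≤ n) (hpar : 2 ∣ n - m)
    (K : Fin s → Type*) [∀ j, Field (K j)] [∀ j, Fintype (K j)] [∀ j, Algebra (ZMod p) (K j)]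
    (hK : ∀ j, Fintype.card (K j) = p ^ nj j)
    (L : Type*) [Field L] [Fintype L] [DecidableEq L] [Algebra (ZMod p) L]
    (hL : Fintype.card L = p ^ m)
    (k : Type*) [Field k] [∀ j, Algebra k (K j)] [Algebra k L]
    (hk : Nat.card k = p ^ t)
    (F Fs : (∀ j, K j) → L) (l d : ℤ) (υ : ℂ)
    (hF : HybridSum.ConditionII p k n m l d υ F Fs)
    (a : ∀ j, K j) (ha : a ≠ 0) :
    (Fs a = 0 →
      HybridSum.hybridSum p F a =
        ((p : ℂ) ^ m - 1) / (p : ℂ) ^ m * υ * (((p : ℝ) ^ ((n : ℝ) / 2) : ℝ) : ℂ) *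
          (-1) ^ (m - 1) * HybridSum.epsilon p ^ m * ((Real.sqrt ((p : ℝ) ^ m) : ℝ) : ℂ) *
          ((quadraticChar L (-1) : ℤ) : ℂ)) ∧
    (Fs a ≠ 0 →
      HybridSum.hybridSum p F a =
        -(1 / (p : ℂ) ^ m) * υ * (((p : ℝ) ^ ((n : ℝ) / 2) : ℝ) : ℂ) *
          (-1) ^ (m - 1) * HybridSum.epsilon p ^ m * ((Real.sqrt ((p : ℝ) ^ m) : ℝ) : ℂ) *
          ((quadraticChar L (-1) : ℤ) : ℂ)) := by
  have h := hF.hybridSum_eq hp hL a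
  rw [HybridSum.quadGaussSum_eq hp hL] at h
  refine ⟨fun h0 => ?_, fun h0 => ?_⟩
  · rw [h, if_pos h0]; ring
  · rw [h, if_neg h0]; ring
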